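/- Let $n\ge 1$, let $\Omega^n$ be the open unit ball of $\mathbb{R}^n$ and $Z=\mathbb{R}\times S^{n-1}$ with the measure $ds\,d\theta$. For an integrable $f:\mathbb{R}^n\to\mathbb{C}$ let $$Rf(s,\theta)=\int_{x\cdot\theta=s}f(x)\,dx,\qquad R_Hf(s,\theta)=\int_{-\infty}^{s}Rf(r,\theta)\,dr$$ be its hyperplane Radon transform (integration with respect to surface measure) and its half-space Radon transform, and let $$\|f\|_{H^{1/2}}=\Big(\int_{\mathbb{R}^n}(1+|\xi|^2)^{1/2}|\hat f(\xi)|^2\,d\xi\Big)^{1/2},\qquad \hat f(\xi)=(2\pi)^{-n/2}\int_{\mathbb{R}^n}f(x)e^{-ix\cdot\xi}\,dx .$$ Then there is a constant $c(n)>0$, depending only on $n$, with the following property. Let $\varepsilon,\rho\in\mathbb{R}$, let $f\in C_0^\infty(\Omega^n)$, let $f^\varepsilon$ be an integrable function on $\mathbb{R}^n$, and let $g^\varepsilon:Z\to\mathbb{C}$ be measurable. If $$\|f\|_{H^{1/2}}\le\rho,\qquad \|f^\varepsilon\|_{H^{1/2}}\le\rho,\qquad \|R_Hf-g^\varepsilon\|_{L^2(Z)}<\varepsilon,\qquad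 \|R_Hf^\varepsilon-g^\varepsilon\|_{L^2(Z)}\le\varepsilon,$$ then $$\|f-f^\varepsilon\|_{L^2(\mathbb{R}^n)}\le c(n)\,\varepsilon^{1/(n+2)}\rho^{1-1/(n+2)} .$$ -/

import Mathlib

open MeasureTheory
open scoped ENNReal ContDiff

noncomputable section

namespace HalfSpaceRadon

/-- Euclidean space `ℝⁿ`. -/
abbrev E (n : ℕ) := EuclideanSpace ℝ (Fin n)

/-- The cylinder `Z = ℝ × S^{n-1}`. -/
abbrev Z (n : ℕ) := ℝ × Metric.sphere (0 : E n) 1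

/-- The measure `ds dθ` on `Z`, where `dθ` is the surface measure of the unit sphere. -/
def cylinderMeasure (n : ℕ) : Measure (Z n) :=
  (volume : Measure ℝ).prod (volume : Measure (E n)).toSphere

/-- `C₀^∞(Ωⁿ)` for the open unit ball `Ωⁿ`: smooth functions whose support is a compact subset
of the ball (extended by zero to `ℝⁿ`). -/
def IsTestFunctionOnBall (n : ℕ) (f : E n → ℂ) : Prop :=
  ContDiff ℝ ∞ f ∧ HasCompactSupport f ∧ tsupport f ⊆ Metric.ball 0 1

/-- The hyperplane Radon transform `Rf(s, θ) = ∫ f(x) δ(x · θ - s) dx`: the integral of `f`, with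
respect to the surface measure, over the hyperplane `{x | x · θ = s} = sθ + θ^⊥`. -/
def radon {n : ℕ} (f : E n → ℂ) (s : ℝ) (θ : Metric.sphere (0 : E n) 1) : ℂ :=
  ∫ y : ↥(Submodule.span ℝ {(θ : E n)})ᗮ, f (s • (θ : E n) + (y : E n))

/-- The half space Radon transform `R_H f(s, θ) = ∫_{-∞}^s Rf(r, θ) dr`. -/
def halfSpaceRadon {n : ℕ} (f : E n → ℂ) (z : Z n) : ℂ :=
  ∫ r in Set.Iic z.1, radon f r z.2

/-- The Fourier transform `f̂(ξ) = (2π)^{-n/2} ∫ f(x) e^{-i x·ξ} dx`. -/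
def fourier {n : ℕ} (f : E n → ℂ) (ξ : E n) : ℂ :=
  (((2 * Real.pi) ^ (-(n : ℝ) / 2) : ℝ) : ℂ) *
    ∫ x : E n, f x * Complex.exp (-Complex.I * ((inner ℝ x ξ : ℝ) : ℂ))

/-- The Sobolev norm `‖f‖_{H^α(ℝⁿ)} = (∫ (1 + |ξ|²)^α |f̂(ξ)|² dξ)^{1/2}` of an integrable function,
with value `∞` if `f` is not in `H^α(ℝⁿ)`. -/
def sobolevNorm {n : ℕ} (α : ℝ) (f : E n → ℂ) : ℝ≥0∞ :=
  (∫⁻ ξ : E n, ENNReal.ofReal ((1 + ‖ξ‖ ^ 2) ^ α) * ‖fourier f ξ‖ₑ ^ 2) ^ (1 / 2 : ℝ)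

end HalfSpaceRadon

end

namespace HalfSpaceRadon

open SchwartzMap FourierTransform

/-! Put $h=f-f^\varepsilon$. For fixed $\theta$, $G_\theta(s)=R_Hh(s,\theta)$ is the integral of $h$
over $x\cdot\theta\le s$, so its derivative is the push-forward of $h\,dx$ under $x\mapsto
x\cdot\theta$. The Fourier slice theorem then gives $\hat G_\theta(\sigma)=\hat
h(\sigma\theta)/(2\pi i\sigma)$, and Plancherel in $s$ with polar coordinates in $\xi$ bounds
$\int|\xi|^{-(n+1)}|\hat h|^2$ by $(2\pi)^2\|R_Hh\|^2$ (`lintegral_rpow_mul_fourier_le`).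

Hölder interpolates between this norm of order $-(n+1)/2$ and the one of order $1/2$; order $0$
carries the weights $1/(n+2)$ and $1-1/(n+2)$ (`lintegral_sq_le_interpolation`). The triangle
inequality bounds the two norms by multiples of $\varepsilon$ and $\rho$, and Plancherel returns to
$h$.

As $h$ is only integrable and $G_\theta$ only square integrable, the Fourier identities are tested
against Schwartz functions (`lintegral_charFun_div_sq_le`, `eLpNorm_fourier_eq`). -/

theorem eLpNorm_two_sq {α : Type*} [MeasurableSpace α] {μ : Measure α} (f : α → ℂ) :
    eLpNorm f 2 μ ^ 2 = ∫⁻ x, ‖f x‖ₑ ^ 2 ∂μ := by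
  simpa using eLpNorm_nnreal_pow_eq_lintegral (f := f) (μ := μ) (p := 2) two_ne_zero

/-! ### Plancherel for integrable functions -/

section Plancherel

variable {V : Type*} [NormedAddCommGroup V] [InnerProductSpace ℝ V] [FiniteDimensional ℝ V]
  [MeasurableSpace V] [BorelSpace V]

/-- Locally integrable functions that agree as distributions agree almost everywhere. -/
theorem ae_eq_of_forall_integral_schwartz_eq {f g : V → ℂ} (hf : LocallyIntegrable f volume)
    (hg : LocallyIntegrable g volume)
    (h : ∀ ψ : 𝓢(V, ℂ), ∫ x, ψ x • f x = ∫ x, ψ x • g x) : f =ᵐ[volume] g := by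
  refine ae_eq_of_integral_contDiff_smul_eq hf hg fun φ hφ hφc => ?_
  have hc : HasCompactSupport (fun x => (φ x : ℂ)) :=
    hφc.comp_left (g := fun r : ℝ => (r : ℂ)) Complex.ofReal_zero
  have hs : ContDiff ℝ ∞ (fun x => (φ x : ℂ)) := Complex.ofRealCLM.contDiff.comp hφ
  simpa using h (hc.toSchwartzMap hs)

theorem integral_fourier_schwartz_smul {h : V → ℂ} (hh : Integrable h volume) (φ : 𝓢(V, ℂ)) :
    ∫ x, 𝓕 φ x • h x = ∫ ξ, φ ξ • 𝓕 h ξ := by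
  have := VectorFourier.integral_fourierIntegral_smul_eq_flip (L := innerₗ V)
    Real.continuous_fourierChar continuous_inner (φ.integrable (μ := volume)) hh
  rw [flip_innerₗ] at this
  exact this

/-- The pairing of Schwartz functions with `L²` functions intertwines the Fourier transforms. -/
theorem integral_schwartz_smul_fourier_Lp (u : Lp (α := V) ℂ 2 (volume : Measure V)) (φ : 𝓢(V, ℂ)) :
    ∫ ξ, φ ξ • (𝓕 u : Lp (α := V) ℂ 2 (volume : Measure V)) ξ = ∫ x, 𝓕 φ x • u x := by
  have := congrArg (fun T : 𝓢'(V, ℂ) => T φ) (Lp.fourier_toTemperedDistribution_eq u)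
  simpa [Lp.toTemperedDistribution_apply] using this.symm

theorem Lp_two_locallyIntegrable (u : Lp (α := V) ℂ 2 (volume : Measure V)) : LocallyIntegrable u volume :=
  MemLp.locallyIntegrable (μ := volume) (Lp.memLp u) one_le_two

/-- Plancherel's theorem for an integrable function whose Fourier transform is square integrable. -/
theorem eLpNorm_fourier_eq {h : V → ℂ} (hh : Integrable h volume) (h2 : MemLp (𝓕 h) 2 volume) :
    eLpNorm (𝓕 h) 2 volume = eLpNorm h 2 volume := by
  set w : Lp (α := V) ℂ 2 (volume : Measure V) := h2.toLp _ with hw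
  set u : Lp (α := V) ℂ 2 (volume : Measure V) := 𝓕⁻ w with hu
  have hwu : 𝓕 u = w := fourier_fourierInv_eq w
  have hae : h =ᵐ[volume] u := by
    refine ae_eq_of_forall_integral_schwartz_eq hh.locallyIntegrable (Lp_two_locallyIntegrable u)
      fun ψ => ?_
    -- Since $\mathcal F$ is onto the Schwartz space, both pairings can be moved to the frequency
    -- side, where `𝓕 h` and `w` agree almost everywhere.
    obtain ⟨φ, rfl⟩ : ∃ φ : 𝓢(V, ℂ), 𝓕 φ = ψ := ⟨𝓕⁻ ψ, fourier_fourierInv_eq ψ⟩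
    rw [integral_fourier_schwartz_smul hh, ← integral_schwartz_smul_fourier_Lp, hwu]
    refine integral_congr_ae ?_
    filter_upwards [h2.coeFn_toLp] with x hx
    rw [hw, hx]
  have hn : ‖w‖ = ‖u‖ := by rw [← hwu, Lp.norm_fourier_eq]
  have he : ‖w‖ₑ = ‖u‖ₑ := by rw [← ofReal_norm, ← ofReal_norm, hn]
  rw [Lp.enorm_def, Lp.enorm_def] at he
  rw [eLpNorm_congr_ae hae, ← he, eLpNorm_congr_ae h2.coeFn_toLp]

end Plancherel

/-! ### Fourier transform of a distribution function on the line -/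

section Primitive

variable {α : Type*} [MeasurableSpace α] {μ : Measure α} [SFinite μ]

theorem schwartz_integral_Ici_deriv (φ : 𝓢(ℝ, ℂ)) (a : ℝ) :
    ∫ s in Set.Ici a, deriv φ s = - φ a := by
  rw [integral_Ici_eq_integral_Ioi]
  have := integral_Ioi_of_hasDerivAt_of_tendsto' (f := φ) (f' := deriv φ) (a := a) (m := 0)
    (fun x _ => φ.hasDerivAt x) ((derivCLM ℂ ℂ φ).integrable.integrableOn) ?_
  · simpa using this
  · exact (φ.tendsto_cocompact).mono_left atTop_le_cocompact

/-- Integration by parts for the distribution function of the complex measure `h μ` along `p`. -/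
theorem integral_deriv_smul_setIntegral_le {h : α → ℂ} (hh : Integrable h μ) {p : α → ℝ}
    (hp : Measurable p) (φ : 𝓢(ℝ, ℂ)) :
    ∫ s, deriv φ s • ∫ x in {x | p x ≤ s}, h x ∂μ = - ∫ x, φ (p x) • h x ∂μ := by
  have hms : MeasurableSet {q : ℝ × α | p q.2 ≤ q.1} :=
    measurableSet_le (hp.comp measurable_snd) measurable_fst
  have hint : Integrable (Function.uncurry fun (s : ℝ) (x : α) =>
      {q : ℝ × α | p q.2 ≤ q.1}.indicator (fun q => deriv φ q.1 • h q.2) (s, x))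
      (volume.prod μ) :=
    (Integrable.smul_prod (derivCLM ℂ ℂ φ).integrable hh).indicator hms
  -- Fubini on the region $p(x)\le s$: for fixed $x$ the inner integral is
  -- $\int_{p(x)}^\infty\varphi'=-\varphi(p(x))$.
  calc ∫ s, deriv φ s • ∫ x in {x | p x ≤ s}, h x ∂μ
      = ∫ s, ∫ x, {q : ℝ × α | p q.2 ≤ q.1}.indicator
          (fun q => deriv φ q.1 • h q.2) (s, x) ∂μ := by
        refine integral_congr_ae (ae_of_all _ fun s => ?_)
        dsimp only
        rw [← integral_smul, ← integral_indicator (measurableSet_le hp measurable_const)]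
        rfl
    _ = ∫ x, (∫ s, {q : ℝ × α | p q.2 ≤ q.1}.indicator
          (fun q => deriv φ q.1 • h q.2) (s, x)) ∂μ := integral_integral_swap hint
    _ = ∫ x, (- φ (p x)) • h x ∂μ := by
        refine integral_congr_ae (ae_of_all _ fun x => ?_)
        dsimp only
        rw [← schwartz_integral_Ici_deriv, ← integral_smul_const,
          ← integral_indicator measurableSet_Ici]
        rfl
    _ = _ := by simp [integral_neg]

/-- Fubini puts the Fourier transform on the test function; this is how the characteristic function
of the push-forward of $h\mu$ under $p$ is recognised as a distribution. -/
theorem integral_schwartz_smul_charFun {h : α → ℂ} (hh : Integrable h μ) {p : α → ℝ}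
    (hp : Measurable p) (ψ : 𝓢(ℝ, ℂ)) :
    ∫ σ, ψ σ • ∫ x, Real.fourierChar (-(p x * σ)) • h x ∂μ = ∫ x, 𝓕 ψ (p x) • h x ∂μ := by
  have hint : Integrable (Function.uncurry fun (σ : ℝ) (x : α) =>
      ψ σ • (Real.fourierChar (-(p x * σ)) • h x)) (volume.prod μ) := by
    have h0 := Integrable.smul_prod (ψ.integrable (μ := volume)) hh
    refine (h0.norm).mono' ?_ (ae_of_all _ fun q => ?_)
    · refine AEStronglyMeasurable.smul (f := fun q : ℝ × α => ψ q.1)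
        (ψ.continuous.measurable.comp measurable_fst).aestronglyMeasurable ?_
      refine AEStronglyMeasurable.smul (f := fun q : ℝ × α => Real.fourierChar (-(p q.2 * q.1)))
        ?_ hh.aestronglyMeasurable.comp_snd
      exact Real.continuous_fourierChar.comp_aestronglyMeasurable
        ((hp.comp measurable_snd).mul measurable_fst).neg.aestronglyMeasurable
    · simp [Function.uncurry]
  calc ∫ σ, ψ σ • ∫ x, Real.fourierChar (-(p x * σ)) • h x ∂μ
      = ∫ σ, ∫ x, ψ σ • (Real.fourierChar (-(p x * σ)) • h x) ∂μ := by
        simp_rw [integral_smul]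
    _ = ∫ x, (∫ σ, ψ σ • (Real.fourierChar (-(p x * σ)) • h x)) ∂μ := integral_integral_swap hint
    _ = ∫ x, 𝓕 ψ (p x) • h x ∂μ := by
        refine integral_congr_ae (ae_of_all _ fun x => ?_)
        dsimp only
        rw [fourier_coe, Real.fourier_eq, ← integral_smul_const]
        refine integral_congr_ae (ae_of_all _ fun σ => ?_)
        dsimp only
        simp only [Circle.smul_def, smul_eq_mul, conj_trivial, RCLike.inner_apply]
        ring_nf

omit [SFinite μ] in
theorem continuous_charFun {h : α → ℂ} (hh : Integrable h μ) {p : α → ℝ} (hp : Measurable p) :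
    Continuous fun σ : ℝ => ∫ x, Real.fourierChar (-(p x * σ)) • h x ∂μ := by
  refine continuous_of_dominated (bound := fun x => ‖h x‖) (fun σ => ?_) (fun σ => ?_) hh.norm ?_
  · refine AEStronglyMeasurable.smul (f := fun x => Real.fourierChar (-(p x * σ))) ?_
      hh.aestronglyMeasurable
    exact Real.continuous_fourierChar.comp_aestronglyMeasurable
      (hp.mul measurable_const).neg.aestronglyMeasurable
  · simp
  · refine ae_of_all _ fun x => ?_
    fun_prop

/-- If the distribution function of `h μ` along `p` is in `L²(ℝ)`, then the characteristic
function, divided by the frequency, is in `L²(ℝ)` as well. -/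
theorem lintegral_charFun_div_sq_le {h : α → ℂ} (hh : Integrable h μ) {p : α → ℝ}
    (hp : Measurable p)
    (hG : MemLp (fun s : ℝ => ∫ x in {x | p x ≤ s}, h x ∂μ) 2 volume) :
    ∫⁻ σ : ℝ, ENNReal.ofReal (|σ| ^ (-2 : ℝ)) *
        ‖∫ x, Real.fourierChar (-(p x * σ)) • h x ∂μ‖ₑ ^ 2 ≤
      ENNReal.ofReal ((2 * Real.pi) ^ 2) *
        ∫⁻ s : ℝ, ‖∫ x in {x | p x ≤ s}, h x ∂μ‖ₑ ^ 2 := by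
  set w : Lp (α := ℝ) ℂ 2 (volume : Measure ℝ) := hG.toLp _ with hw
  set H : ℝ → ℂ := fun σ => ∫ x, Real.fourierChar (-(p x * σ)) • h x ∂μ with hH
  -- The distributional form of $\widehat{G'}=2\pi i\sigma\,\hat G$, where $G'$ is the push-forward
  -- of $h\mu$ under $p$. The sign in `hder` cancels that of the integration by parts.
  have hae : H =ᵐ[volume] fun σ : ℝ =>
      (2 * Real.pi * Complex.I * σ : ℂ) • (𝓕 w : Lp (α := ℝ) ℂ 2 (volume : Measure ℝ)) σ := by
    refine ae_eq_of_forall_integral_schwartz_eq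
      (continuous_charFun hh hp).locallyIntegrable ?_ fun ψ => ?_
    · exact (Lp_two_locallyIntegrable (𝓕 w)).continuous_smul (by fun_prop)
    · have hder (s : ℝ) : 𝓕 ((2 * Real.pi * Complex.I) •
          smulLeftCLM ℂ (fun x : ℝ => inner ℝ x (1 : ℝ)) ψ) s = - deriv (𝓕 ψ : 𝓢(ℝ, ℂ)) s := by
        have h1 := congrArg (fun T : 𝓢(ℝ, ℂ) => T s) (lineDerivOp_fourier_eq ψ (1 : ℝ))
        simp only [lineDerivOp_apply_eq_fderiv, fderiv_apply_one_eq_deriv] at h1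
        rw [h1, neg_smul, FourierTransform.fourier_neg, neg_apply, neg_neg]
      have htg : (fun x : ℝ => inner ℝ x (1 : ℝ)).HasTemperateGrowth :=
        ((innerSL ℝ).flip (1 : ℝ)).hasTemperateGrowth
      have h2 := integral_deriv_smul_setIntegral_le hh hp (𝓕 ψ)
      rw [integral_schwartz_smul_charFun hh hp, ← neg_eq_iff_eq_neg.2 h2, ← integral_neg]
      calc _ = ∫ s, 𝓕 ((2 * Real.pi * Complex.I) •
              smulLeftCLM ℂ (fun x : ℝ => inner ℝ x (1 : ℝ)) ψ) s • w s := by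
            refine integral_congr_ae ?_
            filter_upwards [hG.coeFn_toLp] with s hs
            rw [hder, hw, hs, neg_smul]
        _ = _ := by
            rw [← integral_schwartz_smul_fourier_Lp]
            refine integral_congr_ae (ae_of_all _ fun σ => ?_)
            dsimp only
            rw [smul_apply, smulLeftCLM_apply_apply htg]
            simp
            ring
  have hw2 : ∫⁻ s : ℝ, ‖∫ x in {x | p x ≤ s}, h x ∂μ‖ₑ ^ 2 =
      ∫⁻ σ, ‖(𝓕 w : Lp (α := ℝ) ℂ 2 (volume : Measure ℝ)) σ‖ₑ ^ 2 := by
    have he : ‖(𝓕 w : Lp (α := ℝ) ℂ 2 (volume : Measure ℝ))‖ₑ = ‖w‖ₑ := by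
      rw [← ofReal_norm, ← ofReal_norm, Lp.norm_fourier_eq]
    rw [Lp.enorm_def, Lp.enorm_def, eLpNorm_congr_ae hG.coeFn_toLp] at he
    rw [← eLpNorm_two_sq, ← eLpNorm_two_sq, he]
  rw [hw2, ← lintegral_const_mul' _ _ ENNReal.ofReal_ne_top]
  refine lintegral_mono_ae ?_
  filter_upwards [hae, compl_mem_ae_iff.2 (measure_singleton (0 : ℝ))] with σ hσ h0
  have hσ' : ‖H σ‖ₑ = ENNReal.ofReal (2 * Real.pi * |σ|) * ‖(𝓕 w : Lp (α := ℝ) ℂ 2 (volume : Measure ℝ)) σ‖ₑ := by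
    rw [hσ, enorm_smul, ← ofReal_norm]
    simp [abs_of_pos Real.pi_pos]
  rw [hσ', mul_pow, ← mul_assoc, ← ENNReal.ofReal_pow (by positivity),
    ← ENNReal.ofReal_mul (by positivity)]
  gcongr
  rw [Real.rpow_neg (abs_nonneg _), Real.rpow_two]
  have : |σ| ≠ 0 := abs_ne_zero.2 h0
  apply le_of_eq
  field_simp

end Primitive

/-! ### Half-space integrals by slicing -/

section Slices

variable {n : ℕ}

theorem measurePreserving_smul_add (θ : Metric.sphere (0 : E n) 1) :
    MeasurePreserving (fun q : ℝ × ↥(Submodule.span ℝ {(θ : E n)})ᗮ =>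
      q.1 • (θ : E n) + (q.2 : E n)) := by
  have hθ : ‖(θ : E n)‖ = 1 := norm_eq_of_mem_sphere θ
  have h1 := (LinearIsometryEquiv.toSpanUnitSingleton (𝕜 := ℝ) (θ : E n) hθ).measurePreserving.prod
    (MeasurePreserving.id (volume : Measure ↥(Submodule.span ℝ {(θ : E n)})ᗮ))
  have h2 := WithLp.volume_preserving_toLp ↥(Submodule.span ℝ {(θ : E n)})
    ↥(Submodule.span ℝ {(θ : E n)})ᗮ
  have h3 := (Submodule.span ℝ {(θ : E n)}).orthogonalDecomposition.symm.measurePreserving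
  convert! h3.comp (h2.comp h1) using 1

/-- The half space Radon transform is the integral over the half space. -/
theorem halfSpaceRadon_eq_setIntegral {f : E n → ℂ} (hf : Integrable f volume) (z : Z n) :
    halfSpaceRadon f z = ∫ x in {x | inner ℝ x (z.2 : E n) ≤ z.1}, f x := by
  have hθ : ‖(z.2 : E n)‖ = 1 := norm_eq_of_mem_sphere z.2
  have hm : MeasurableSet {x : E n | inner ℝ x (z.2 : E n) ≤ z.1} :=
    measurableSet_le (by fun_prop) measurable_const
  have hmp := measurePreserving_smul_add z.2
  have hi := hf.indicator hm
  have hinner (r : ℝ) (y : ↥(Submodule.span ℝ {(z.2 : E n)})ᗮ) :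
      inner ℝ (r • (z.2 : E n) + (y : E n)) (z.2 : E n) = r := by
    have : inner ℝ (y : E n) (z.2 : E n) = 0 :=
      (Submodule.mem_orthogonal' _ _).1 y.2 _ (Submodule.mem_span_singleton_self _)
    rw [inner_add_left, this, real_inner_smul_left, real_inner_self_eq_norm_sq, hθ]
    simp
  rw [← integral_indicator hm, ← hmp.map_eq, integral_map hmp.aemeasurable
    (by rw [hmp.map_eq]; exact hi.aestronglyMeasurable)]
  have hi' := hmp.integrable_comp_of_integrable hi
  simp only [Function.comp_def] at hi'
  rw [Measure.volume_eq_prod, integral_prod _ hi', halfSpaceRadon, ← integral_indicator measurableSet_Iic]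
  refine integral_congr_ae (ae_of_all _ fun r => ?_)
  by_cases hr : r ≤ z.1
  · simp [Set.indicator, hinner, hr, radon]
  · simp [Set.indicator, hinner, hr]

/-- Joint measurability in $(s,\theta)$ is what Tonelli on the cylinder needs; it follows from
integrating a jointly measurable indicator in $x$. -/
theorem stronglyMeasurable_halfSpaceRadon {f : E n → ℂ} (hf : Integrable f volume) :
    StronglyMeasurable (halfSpaceRadon f) := by
  have hms : MeasurableSet {q : Z n × E n | inner ℝ q.2 (q.1.2 : E n) ≤ q.1.1} :=
    measurableSet_le (by fun_prop) (by fun_prop)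
  have h1 : StronglyMeasurable ({q : Z n × E n | inner ℝ q.2 (q.1.2 : E n) ≤ q.1.1}.indicator
      fun q => hf.1.mk f q.2) :=
    (hf.1.stronglyMeasurable_mk.comp_measurable measurable_snd).indicator hms
  convert! h1.integral_prod_right' (ν := (volume : Measure (E n))) using 1
  ext z
  have hm : MeasurableSet {x : E n | inner ℝ x (z.2 : E n) ≤ z.1} :=
    measurableSet_le (by fun_prop) measurable_const
  rw [halfSpaceRadon_eq_setIntegral hf, ← integral_indicator hm]
  refine integral_congr_ae ?_
  filter_upwards [hf.1.ae_eq_mk] with x hx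
  simp [Set.indicator, hx]

theorem halfSpaceRadon_sub {f g : E n → ℂ} (hf : Integrable f volume) (hg : Integrable g volume)
    (z : Z n) : halfSpaceRadon (fun x => f x - g x) z = halfSpaceRadon f z - halfSpaceRadon g z := by
  rw [halfSpaceRadon_eq_setIntegral hf, halfSpaceRadon_eq_setIntegral hg,
    halfSpaceRadon_eq_setIntegral (f := fun x => f x - g x) (hf.sub hg),
    integral_sub hf.integrableOn hg.integrableOn]

end Slices

/-! ### Polar coordinates and the negative order estimate -/

section Polar

variable {n : ℕ}

theorem lintegral_polar (hn : 1 ≤ n) {F : E n → ℝ≥0∞} (hF : Measurable F) :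
    ∫⁻ ξ, F ξ = ∫⁻ θ, ∫⁻ r in Set.Ioi (0 : ℝ), ENNReal.ofReal (r ^ (n - 1)) * F (r • (θ : E n))
      ∂volume ∂(volume : Measure (E n)).toSphere := by
  have : Nonempty (Fin n) := ⟨⟨0, hn⟩⟩
  have hmp := (volume : Measure (E n)).measurePreserving_homeomorphUnitSphereProd
  have hFm : Measurable fun q : Metric.sphere (0 : E n) 1 × Set.Ioi (0 : ℝ) =>
      F ((q.2 : ℝ) • (q.1 : E n)) := by
    fun_prop
  calc ∫⁻ ξ, F ξ = ∫⁻ ξ in {(0 : E n)}ᶜ, F ξ := by rw [restrict_compl_singleton]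
    _ = ∫⁻ ξ : ({(0 : E n)}ᶜ : Set (E n)), F ξ ∂(Measure.comap Subtype.val volume) :=
        (lintegral_subtype_comap (measurableSet_singleton _).compl F).symm
    _ = ∫⁻ ξ : ({(0 : E n)}ᶜ : Set (E n)), F ((homeomorphUnitSphereProd (E n) ξ).2.1 •
          ((homeomorphUnitSphereProd (E n) ξ).1 : E n)) ∂(Measure.comap Subtype.val volume) := by
        refine lintegral_congr fun ξ => ?_
        have : ‖(ξ : E n)‖ ≠ 0 := norm_ne_zero_iff.2 ξ.2
        simp [smul_smul, this]
    _ = ∫⁻ q, F ((q.2 : ℝ) • (q.1 : E n)) ∂((volume : Measure (E n)).toSphere.prod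
          (Measure.volumeIoiPow (Module.finrank ℝ (E n) - 1))) := hmp.lintegral_comp hFm
    _ = _ := by
        rw [lintegral_prod _ hFm.aemeasurable]
        refine lintegral_congr fun θ => ?_
        rw [Measure.volumeIoiPow, lintegral_withDensity_eq_lintegral_mul _ (by fun_prop)
          (by fun_prop), finrank_euclideanSpace_fin]
        exact lintegral_subtype_comap measurableSet_Ioi
          (fun r : ℝ => ENNReal.ofReal (r ^ (n - 1)) * F (r • (θ : E n)))

/-- The half space Radon transform controls a homogeneous negative order Sobolev norm. -/
theorem lintegral_rpow_mul_fourier_le (hn : 1 ≤ n) {h : E n → ℂ} (hh : Integrable h volume) :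
    ∫⁻ ξ, ENNReal.ofReal (‖ξ‖ ^ (-((n : ℝ) + 1))) * ‖𝓕 h ξ‖ₑ ^ 2 ≤
      ENNReal.ofReal ((2 * Real.pi) ^ 2) *
        ∫⁻ z, ‖halfSpaceRadon h z‖ₑ ^ 2 ∂cylinderMeasure n := by
  have hcont : Continuous (𝓕 h) := VectorFourier.fourierIntegral_continuous
    Real.continuous_fourierChar (by exact continuous_inner) hh
  have hG := stronglyMeasurable_halfSpaceRadon hh
  rw [lintegral_polar hn (by fun_prop), cylinderMeasure,
    lintegral_prod_symm _ (hG.measurable.enorm.pow_const 2).aemeasurable,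
    ← lintegral_const_mul' _ _ ENNReal.ofReal_ne_top]
  refine lintegral_mono fun θ => ?_
  have hθ : ‖(θ : E n)‖ = 1 := norm_eq_of_mem_sphere θ
  -- An infinite slice norm makes the bound trivial; otherwise the slice is in $L^2(\mathbb R)$ and
  -- the one-dimensional estimate applies.
  by_cases htop : ∫⁻ s, ‖halfSpaceRadon h (s, θ)‖ₑ ^ 2 = ⊤
  · rw [htop, ENNReal.mul_top (by simp [Real.pi_pos.ne'])]
    exact le_top
  have hp : Measurable fun x : E n => inner ℝ x (θ : E n) := by fun_prop
  have hmem : MemLp (fun s : ℝ => ∫ x in {x | inner ℝ x (θ : E n) ≤ s}, h x) 2 volume := by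
    simp_rw [← fun s : ℝ => halfSpaceRadon_eq_setIntegral hh (s, θ)]
    refine ⟨(hG.comp_measurable measurable_prodMk_right).aestronglyMeasurable, ?_⟩
    have := eLpNorm_two_sq (μ := volume) fun s : ℝ => halfSpaceRadon h (s, θ)
    by_contra hc
    rw [not_lt_top_iff.1 hc] at this
    exact htop (this.symm.trans (ENNReal.top_pow two_ne_zero))
  have key := lintegral_charFun_div_sq_le hh hp hmem
  simp_rw [← fun s : ℝ => halfSpaceRadon_eq_setIntegral hh (s, θ)] at key
  refine le_trans ?_ key
  -- Polar coordinates use only $\sigma=r>0$; the negative frequencies are discarded.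
  refine le_trans (le_of_eq ?_) (setLIntegral_le_lintegral (Set.Ioi 0) _)
  refine setLIntegral_congr_fun measurableSet_Ioi fun r hr => ?_
  have hr : 0 < r := hr
  have h1 : 𝓕 h (r • (θ : E n)) =
      ∫ x, Real.fourierChar (-(inner ℝ x (θ : E n) * r)) • h x := by
    rw [Real.fourier_eq]
    simp_rw [real_inner_smul_right, mul_comm r]
  -- The Jacobian fixes the order: $r^{n-1}r^{-(n+1)}=r^{-2}$.
  rw [h1, ← mul_assoc, ← ENNReal.ofReal_mul (by positivity), norm_smul, hθ, mul_one,
    Real.norm_eq_abs, abs_of_pos hr, ← Real.rpow_natCast, ← Real.rpow_add hr, Nat.cast_sub hn]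
  congr 3
  push_cast
  ring

end Polar

/-! ### Sobolev norms and interpolation -/

section Sobolev

variable {n : ℕ}

theorem continuous_fourierIntegral {h : E n → ℂ} (hh : Integrable h volume) :
    Continuous (𝓕 h) :=
  VectorFourier.fourierIntegral_continuous Real.continuous_fourierChar (by exact continuous_inner) hh

theorem fourierIntegral_sub {f g : E n → ℂ} (hf : Integrable f volume)
    (hg : Integrable g volume) (ξ : E n) : 𝓕 (fun x => f x - g x) ξ = 𝓕 f ξ - 𝓕 g ξ := by
  simp only [Real.fourier_eq, smul_sub]
  exact integral_sub ((Real.fourierIntegral_convergent_iff ξ).2 hf)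
    ((Real.fourierIntegral_convergent_iff ξ).2 hg)

theorem fourier_eq_fourierIntegral (f : E n → ℂ) (ξ : E n) :
    fourier f ξ = (((2 * Real.pi) ^ (-(n : ℝ) / 2) : ℝ) : ℂ) * 𝓕 f ((2 * Real.pi)⁻¹ • ξ) := by
  rw [fourier, Real.fourier_eq]
  congr 1
  refine integral_congr_ae (ae_of_all _ fun x => ?_)
  have : (Real.pi : ℂ) ≠ 0 := by simp [Real.pi_ne_zero]
  simp only [Circle.smul_def, smul_eq_mul, real_inner_smul_right, Real.fourierChar_apply]
  rw [mul_comm]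
  congr 2
  push_cast
  field_simp

theorem lintegral_comp_inv_smul {F : E n → ℝ≥0∞} (hF : Measurable F) {c : ℝ} (hc : 0 < c) :
    ∫⁻ ξ, F (c⁻¹ • ξ) = ENNReal.ofReal (c ^ n) * ∫⁻ ξ, F ξ := by
  rw [← lintegral_map hF (measurable_const_smul c⁻¹),
    Measure.map_addHaar_smul _ (inv_ne_zero hc.ne'), lintegral_smul_measure,
    finrank_euclideanSpace_fin, smul_eq_mul, inv_pow, inv_inv, abs_of_pos (by positivity)]

/-- Rescaling $\xi$ by $2\pi$ passes between the two Fourier normalisations: the Jacobian $(2\pi)^n$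
cancels the squared prefactor, and $|\xi|/2\pi\le(1+|\xi|^2)^{1/2}$. -/
theorem lintegral_norm_mul_fourier_le {f : E n → ℂ} (hf : Integrable f volume) {ρ : ℝ≥0∞}
    (h : sobolevNorm (1 / 2) f ≤ ρ) : ∫⁻ ξ, ‖ξ‖ₑ * ‖𝓕 f ξ‖ₑ ^ 2 ≤ ρ ^ 2 := by
  have hcont := continuous_fourierIntegral hf
  have hpi : (0 : ℝ) < 2 * Real.pi := by positivity
  have hpi1 : (1 : ℝ) ≤ 2 * Real.pi := by linarith [Real.pi_gt_three]
  have hpn : (0 : ℝ) < (2 * Real.pi) ^ n := by positivity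
  have hs : sobolevNorm (1 / 2) f ^ 2 =
      ∫⁻ ξ : E n, ENNReal.ofReal ((1 + ‖ξ‖ ^ 2) ^ (1 / 2 : ℝ)) * ‖fourier f ξ‖ₑ ^ 2 := by
    rw [sobolevNorm, ← ENNReal.rpow_two, ← ENNReal.rpow_mul]
    norm_num
  refine le_trans ?_ (pow_le_pow_left' h 2)
  rw [hs]
  have hcs := lintegral_comp_inv_smul (F := fun ξ : E n => ‖ξ‖ₑ * ‖𝓕 f ξ‖ₑ ^ 2) (by fun_prop) hpi
  have hcs' : ∫⁻ ξ, ‖ξ‖ₑ * ‖𝓕 f ξ‖ₑ ^ 2 = ENNReal.ofReal (((2 * Real.pi) ^ n)⁻¹) *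
      ∫⁻ ξ : E n, ‖(2 * Real.pi)⁻¹ • ξ‖ₑ * ‖𝓕 f ((2 * Real.pi)⁻¹ • ξ)‖ₑ ^ 2 := by
    rw [hcs, ← mul_assoc, ← ENNReal.ofReal_mul (by positivity), inv_mul_cancel₀ hpn.ne']
    simp
  rw [hcs', ← lintegral_const_mul' _ _ ENNReal.ofReal_ne_top]
  refine lintegral_mono fun ξ => ?_
  have h1 : ‖fourier f ξ‖ₑ ^ 2 =
      ENNReal.ofReal (((2 * Real.pi) ^ n)⁻¹) * ‖𝓕 f ((2 * Real.pi)⁻¹ • ξ)‖ₑ ^ 2 := by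
    rw [fourier_eq_fourierIntegral, enorm_mul, mul_pow, ← ofReal_norm, Complex.norm_real,
      Real.norm_of_nonneg (by positivity), ← ENNReal.ofReal_pow (by positivity),
      ← Real.rpow_natCast, ← Real.rpow_mul hpi.le, ← Real.rpow_natCast, ← Real.rpow_neg hpi.le]
    norm_num
  have h2 : ‖(2 * Real.pi)⁻¹ • ξ‖ₑ ≤ ENNReal.ofReal ((1 + ‖ξ‖ ^ 2) ^ (1 / 2 : ℝ)) := by
    rw [← ofReal_norm, norm_smul, Real.norm_of_nonneg (by positivity), ← Real.sqrt_eq_rpow]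
    refine ENNReal.ofReal_le_ofReal (Real.le_sqrt_of_sq_le ?_)
    have : (2 * Real.pi)⁻¹ * ‖ξ‖ ≤ ‖ξ‖ :=
      mul_le_of_le_one_left (norm_nonneg _) (inv_le_one_of_one_le₀ hpi1)
    nlinarith [pow_le_pow_left₀ (by positivity) this 2]
  rw [h1, mul_left_comm]
  gcongr

theorem enorm_sub_sq_le (a b : ℂ) : ‖a - b‖ₑ ^ 2 ≤ 2 * (‖a‖ₑ ^ 2 + ‖b‖ₑ ^ 2) := by
  refine (pow_le_pow_left' (enorm_sub_le (a := a) (b := b)) 2).trans ?_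
  have := ENNReal.rpow_add_le_mul_rpow_add_rpow ‖a‖ₑ ‖b‖ₑ one_le_two
  norm_num at this
  exact this

theorem lintegral_norm_mul_fourier_sub_le {f g : E n → ℂ} (hf : Integrable f volume)
    (hg : Integrable g volume) {ρ : ℝ≥0∞} (hfρ : sobolevNorm (1 / 2) f ≤ ρ)
    (hgρ : sobolevNorm (1 / 2) g ≤ ρ) :
    ∫⁻ ξ, ‖ξ‖ₑ * ‖𝓕 (fun x => f x - g x) ξ‖ₑ ^ 2 ≤ (2 * ρ) ^ 2 := by
  have hcont := continuous_fourierIntegral hf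
  calc _ ≤ ∫⁻ ξ, 2 * (‖ξ‖ₑ * ‖𝓕 f ξ‖ₑ ^ 2 + ‖ξ‖ₑ * ‖𝓕 g ξ‖ₑ ^ 2) := by
        refine lintegral_mono fun ξ => ?_
        rw [fourierIntegral_sub hf hg, ← mul_add, mul_left_comm]
        gcongr
        exact enorm_sub_sq_le _ _
    _ ≤ 2 * (ρ ^ 2 + ρ ^ 2) := by
        rw [lintegral_const_mul' _ _ ENNReal.ofNat_ne_top, lintegral_add_left (by fun_prop)]
        gcongr
        · exact lintegral_norm_mul_fourier_le hf hfρ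
        · exact lintegral_norm_mul_fourier_le hg hgρ
    _ = (2 * ρ) ^ 2 := by ring

/-- Interpolation between the homogeneous Sobolev norms of orders `-(n + 1) / 2` and `1 / 2`. -/
theorem lintegral_sq_le_interpolation (hn : 1 ≤ n) {F : E n → ℂ} (hF : Continuous F) :
    ∫⁻ ξ, ‖F ξ‖ₑ ^ 2 ≤
      (∫⁻ ξ, ENNReal.ofReal (‖ξ‖ ^ (-((n : ℝ) + 1))) * ‖F ξ‖ₑ ^ 2) ^ (1 / ((n : ℝ) + 2)) *
        (∫⁻ ξ, ‖ξ‖ₑ * ‖F ξ‖ₑ ^ 2) ^ (1 - 1 / ((n : ℝ) + 2)) := by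
  have : Nonempty (Fin n) := ⟨⟨0, hn⟩⟩
  have ha : 0 ≤ 1 / ((n : ℝ) + 2) := by positivity
  have hb : 0 ≤ 1 - 1 / ((n : ℝ) + 2) := by
    rw [sub_nonneg, div_le_one (by positivity)]
    linarith [(n.cast_nonneg : (0 : ℝ) ≤ n)]
  -- Hölder with $a=1/(n+2)$, the solution of $-(n+1)a+(1-a)=0$, so that the powers of $|\xi|$
  -- cancel.
  refine le_trans (le_of_eq ?_) (ENNReal.lintegral_mul_norm_pow_le (by fun_prop) (by fun_prop)
    ha hb (by ring))
  refine lintegral_congr_ae ?_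
  -- Both weights take the value $0$ at the origin, so the identity can fail there; the point is
  -- null because $n\ge1$.
  filter_upwards [compl_mem_ae_iff.2 (measure_singleton (0 : E n))] with ξ hξ
  have hξ : 0 < ‖ξ‖ := norm_pos_iff.2 hξ
  rw [ENNReal.mul_rpow_of_nonneg _ _ ha, ENNReal.mul_rpow_of_nonneg _ _ hb, mul_mul_mul_comm,
    ← ENNReal.rpow_add_of_nonneg _ _ ha hb, add_sub_cancel, ENNReal.rpow_one, ← ofReal_norm ξ,
    ENNReal.ofReal_rpow_of_pos (by positivity), ENNReal.ofReal_rpow_of_pos hξ,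
    ← ENNReal.ofReal_mul (by positivity), ← Real.rpow_mul hξ.le, ← Real.rpow_add hξ]
  have : -((n : ℝ) + 1) * (1 / ((n : ℝ) + 2)) + (1 - 1 / ((n : ℝ) + 2)) = 0 := by
    field_simp
    ring
  rw [this]
  simp

end Sobolev

/-! ### Conditional stability -/

section Stability

variable {n : ℕ}

theorem eLpNorm_halfSpaceRadon_sub_le {f g : E n → ℂ} {γ : Z n → ℂ} (hf : Integrable f volume)
    (hg : Integrable g volume) (hγ : AEStronglyMeasurable γ (cylinderMeasure n)) {ε : ℝ≥0∞}
    (hfε : eLpNorm (fun z => halfSpaceRadon f z - γ z) 2 (cylinderMeasure n) ≤ ε)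
    (hgε : eLpNorm (fun z => halfSpaceRadon g z - γ z) 2 (cylinderMeasure n) ≤ ε) :
    eLpNorm (halfSpaceRadon fun x => f x - g x) 2 (cylinderMeasure n) ≤ 2 * ε := by
  have h1 : halfSpaceRadon (fun x => f x - g x) =
      (fun z => halfSpaceRadon f z - γ z) - fun z => halfSpaceRadon g z - γ z := by
    ext z
    simp [halfSpaceRadon_sub hf hg]
  rw [h1, two_mul]
  exact (eLpNorm_sub_le ((stronglyMeasurable_halfSpaceRadon hf).aestronglyMeasurable.sub hγ)
    ((stronglyMeasurable_halfSpaceRadon hg).aestronglyMeasurable.sub hγ) one_le_two).trans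
    (add_le_add hfε hgε)

/-- Conditional stability of the inversion of the half space Radon transform. -/
theorem eLpNorm_le_of_halfSpaceRadon (hn : 1 ≤ n) {h : E n → ℂ} (hh : Integrable h volume)
    {ε ρ : ℝ≥0∞} (hε : ε ≠ ⊤) (hρ : ρ ≠ ⊤)
    (hG : eLpNorm (halfSpaceRadon h) 2 (cylinderMeasure n) ≤ ε)
    (hS : ∫⁻ ξ, ‖ξ‖ₑ * ‖𝓕 h ξ‖ₑ ^ 2 ≤ ρ ^ 2) :
    eLpNorm h 2 volume ≤ (ENNReal.ofReal (2 * Real.pi) * ε) ^ (1 / ((n : ℝ) + 2)) *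
      ρ ^ (1 - 1 / ((n : ℝ) + 2)) := by
  have hcont := continuous_fourierIntegral hh
  have ha : 0 ≤ 1 / ((n : ℝ) + 2) := by positivity
  have hb : 0 ≤ 1 - 1 / ((n : ℝ) + 2) := by
    rw [sub_nonneg, div_le_one (by positivity)]
    linarith [(n.cast_nonneg : (0 : ℝ) ≤ n)]
  have hA : ∫⁻ ξ, ENNReal.ofReal (‖ξ‖ ^ (-((n : ℝ) + 1))) * ‖𝓕 h ξ‖ₑ ^ 2 ≤
      (ENNReal.ofReal (2 * Real.pi) * ε) ^ 2 := by
    refine (lintegral_rpow_mul_fourier_le hn hh).trans ?_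
    rw [← eLpNorm_two_sq, ENNReal.ofReal_pow (by positivity), ← mul_pow]
    gcongr
  have hsq : eLpNorm (𝓕 h) 2 volume ^ 2 ≤
      ((ENNReal.ofReal (2 * Real.pi) * ε) ^ (1 / ((n : ℝ) + 2)) *
        ρ ^ (1 - 1 / ((n : ℝ) + 2))) ^ 2 := by
    rw [eLpNorm_two_sq]
    refine (lintegral_sq_le_interpolation hn hcont).trans
      ((mul_le_mul' (ENNReal.rpow_le_rpow hA ha) (ENNReal.rpow_le_rpow hS hb)).trans (le_of_eq ?_))
    rw [mul_pow (_ ^ _ : ℝ≥0∞)]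
    simp only [← ENNReal.rpow_two, ← ENNReal.rpow_mul, mul_comm (2 : ℝ)]
  have hle := (ENNReal.pow_le_pow_left_iff two_ne_zero).1 hsq
  -- Finiteness of the bound puts `𝓕 h` in $L^2$, as Plancherel requires.
  have hfin : eLpNorm (𝓕 h) 2 volume < ⊤ := hle.trans_lt <| ENNReal.mul_lt_top
    (ENNReal.rpow_lt_top_of_nonneg ha (ENNReal.mul_ne_top ENNReal.ofReal_ne_top hε))
    (ENNReal.rpow_lt_top_of_nonneg hb hρ)
  rwa [← eLpNorm_fourier_eq hh ⟨hcont.aestronglyMeasurable, hfin⟩]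

theorem IsTestFunctionOnBall.integrable {f : E n → ℂ} (hf : IsTestFunctionOnBall n f) :
    Integrable f volume :=
  hf.1.continuous.integrable_of_hasCompactSupport hf.2.1

end Stability

end HalfSpaceRadon

theorem mainTheorem5 (n : ℕ) (hn : 1 ≤ n) :
    ∃ c : ℝ, 0 < c ∧
      ∀ (ε ρ : ℝ) (f fε : HalfSpaceRadon.E n → ℂ) (gε : HalfSpaceRadon.Z n → ℂ),
        HalfSpaceRadon.IsTestFunctionOnBall n f →
        Integrable fε volume →
        AEStronglyMeasurable gε (HalfSpaceRadon.cylinderMeasure n) →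
        HalfSpaceRadon.sobolevNorm (1 / 2) f ≤ ENNReal.ofReal ρ →
        HalfSpaceRadon.sobolevNorm (1 / 2) fε ≤ ENNReal.ofReal ρ →
        eLpNorm (fun z => HalfSpaceRadon.halfSpaceRadon f z - gε z) 2
          (HalfSpaceRadon.cylinderMeasure n) < ENNReal.ofReal ε →
        eLpNorm (fun z => HalfSpaceRadon.halfSpaceRadon fε z - gε z) 2
          (HalfSpaceRadon.cylinderMeasure n) ≤ ENNReal.ofReal ε →
        eLpNorm (fun x => f x - fε x) 2 volume ≤
          ENNReal.ofReal (c * ε ^ (1 / ((n : ℝ) + 2)) * ρ ^ (1 - 1 / ((n : ℝ) + 2))) := by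
  have ha : 0 < 1 / ((n : ℝ) + 2) := by positivity
  have hb : 0 < 1 - 1 / ((n : ℝ) + 2) := by
    rw [sub_pos, div_lt_one (by positivity)]
    linarith [(n.cast_nonneg : (0 : ℝ) ≤ n)]
  -- The $2\pi$ comes from the slice estimate; each further $2$ comes from estimating a difference,
  -- in the data and in $H^{1/2}$.
  refine ⟨(2 * Real.pi * 2) ^ (1 / ((n : ℝ) + 2)) * 2 ^ (1 - 1 / ((n : ℝ) + 2)), by positivity,
    fun ε ρ f fε gε hf hfε hg hfρ hfερ h1 h2 => ?_⟩
  have hε : 0 < ε := ENNReal.ofReal_pos.1 (bot_le.trans_lt h1)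
  have key := HalfSpaceRadon.eLpNorm_le_of_halfSpaceRadon hn (hf.integrable.sub hfε)
    (ENNReal.mul_ne_top ENNReal.ofNat_ne_top ENNReal.ofReal_ne_top)
    (ENNReal.mul_ne_top ENNReal.ofNat_ne_top ENNReal.ofReal_ne_top)
    (HalfSpaceRadon.eLpNorm_halfSpaceRadon_sub_le hf.integrable hfε hg h1.le h2)
    (HalfSpaceRadon.lintegral_norm_mul_fourier_sub_le hf.integrable hfε hfρ hfερ)
  refine key.trans ?_
  -- For $\rho\le0$ the truncation `ENNReal.ofReal ρ` is $0$ and its exponent is positive, so the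
  -- bound in `key` vanishes, whatever the real power of $\rho$ is.
  rcases le_or_gt ρ 0 with hρ | hρ
  · rw [ENNReal.ofReal_of_nonpos hρ, mul_zero, ENNReal.zero_rpow_of_pos hb, mul_zero]
    exact bot_le
  · rw [← ENNReal.ofReal_ofNat 2, ← ENNReal.ofReal_mul two_pos.le, ← ENNReal.ofReal_mul two_pos.le,
      ← ENNReal.ofReal_mul (by positivity), ENNReal.ofReal_rpow_of_pos (by positivity),
      ENNReal.ofReal_rpow_of_pos (by positivity), ← ENNReal.ofReal_mul (by positivity)]
    refine ENNReal.ofReal_le_ofReal (le_of_eq ?_)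
    rw [← mul_assoc, Real.mul_rpow (x := 2 * Real.pi * 2) (by positivity) hε.le,
      Real.mul_rpow two_pos.le hρ.le]
    ring
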